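/- Let $\mathbb D$ be a set of datasets with a neighbouring relation $\sim$ (for instance, Hamming distance equal to one). A mechanism $\mathcal M:\mathbb D\to\mathcal P(\mathbb X)$ assigns to each dataset $d$ a probability measure $\mathcal M_d$ on a measurable space $\mathbb X$. It is $(\varepsilon,\delta)$-DP ($\varepsilon\ge 0$) if $\mathcal M_d(A)-e^{\varepsilon}\mathcal M_{d'}(A)\le\delta$ for all $d\sim d'$ and all measurable $A\subseteq\mathbb X$, and $(\alpha,\gamma)$-RDP ($\alpha>1$) if $D_\alpha(\mathcal M_d\|\mathcal M_{d'})\le\gamma$ for all $d\sim d'$, where $D_\alpha(P\|Q)=\frac1{\alpha-1}\log\mathbb E_Q\big[(\frac{dP}{dQ})^\alpha\big]$ is the Rényi divergence ($+\infty$ if $P\not\ll Q$). For $\delta\in(0,1)$, $\alpha>1$, $\gamma\ge 0$, $\rho>0$ and $T\in\mathbb N$ let $$\varepsilon_\alpha^\delta(\gamma)=\inf\{\varepsilon\ge 0:\text{ every }(\alpha,\gamma)\text{-RDP mechanism } \mathbb D\to\mathcal P(\mathbb X)\text{ is }(\varepsilon,\delta)\text{-DP}\},\qquad \varepsilon^\delta(\rho,T)=\inf_{\alpha>1}\varepsilon_\alpha^\delta(\rho\alpha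 T).$$ Let $\sigma>0$ and $\rho=\frac1{2\sigma^2}$. The $T$-fold adaptive homogeneous composition of the Gaussian mechanism with variance $\sigma^2$ on $\mathbb R^n$ is the mechanism which, on dataset $d$, outputs $(y_1,\dots,y_T)\in(\mathbb R^n)^T$ where, given $y_1,\dots,y_{i-1}$, the output $y_i$ has law $\mathcal N\big(q_i(d,y_1,\dots,y_{i-1}),\sigma^2 I_n\big)$; here each query $q_i$ may depend on the previous outputs, is measurable in them, and has $L_2$-sensitivity at most one, i.e. $\|q_i(d,y)-q_i(d',y)\|_2\le 1$ for all $d\sim d'$ and all $y$. Then for every $\delta\in(0,1)$: (a) every such $T$-fold composition is $(\varepsilon^\delta(\rho,T),\delta)$-DP, where $\varepsilon^\delta(\rho,T)$ is taken for mechanisms with output space $\mathbb X=(\mathbb R^n)^T$; (b) for every measurable space $\mathbb X$, $$\varepsilon^\delta(\rho,T)\le\min\Big\{\varepsilon_0(\rho,T),\ \varepsilon_1(\rho,T),\ \Big(\frac{\rho T}{\delta}+\log(1-\delta)\Big)_+\Big\},$$ where $(a)_+=\max\{a,0\}$, $\zeta_\alpha=\frac1\alpha\big(1-\frac1\alpha\big)^{\alpha-1}$,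 $$\varepsilon_0(\rho,T)=\inf_{\alpha\in(1,1/\delta]}\Big(\rho\alpha T-\frac1{\alpha-1}\log\frac{\delta}{\zeta_\alpha}\Big)_+,\qquad \varepsilon_1(\rho,T)=\inf_{\alpha\in(1,1/\delta]}\frac1{\alpha-1}\log\Big(1+\frac{e^{\rho\alpha(\alpha-1)T}-1}{\alpha\delta}\Big).$$ -/

import Mathlib

open MeasureTheory ProbabilityTheory
open scoped ENNReal

noncomputable section

namespace RenyiDP

/-! ### Mechanisms and the two privacy notions -/

/-- A mechanism assigns to every dataset a probability measure on the output space. -/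
abbrev Mechanism (D X : Type*) [MeasurableSpace X] := D → ProbabilityMeasure X

/-- The Rényi divergence of order `α > 1`: it is `(α - 1)⁻¹ * log E_Q[(dP/dQ)^α]` when `P ≪ Q`,
and `+∞` otherwise. The integral and the logarithm take extended values. -/
def renyiDiv {X : Type*} [MeasurableSpace X] (α : ℝ) (P Q : Measure X) : EReal :=
  open Classical in
  if P ≪ Q then ((α - 1)⁻¹ : ℝ) * ENNReal.log (∫⁻ x, (P.rnDeriv Q x) ^ α ∂Q) else ⊤

/-- `(ε, δ)`-differential privacy with respect to the neighbouring relation `adj`. -/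
def IsDP {D X : Type*} [MeasurableSpace X] (adj : D → D → Prop) (M : Mechanism D X)
    (ε δ : ℝ) : Prop :=
  ∀ d d' : D, adj d d' → ∀ A : Set X, MeasurableSet A →
    (M d : Measure X).real A - Real.exp ε * (M d' : Measure X).real A ≤ δ

/-- `(α, γ)`-Rényi differential privacy with respect to the neighbouring relation `adj`. -/
def IsRDP {D X : Type*} [MeasurableSpace X] (adj : D → D → Prop) (M : Mechanism D X)
    (α γ : ℝ) : Prop :=
  ∀ d d' : D, adj d d' → renyiDiv α (M d : Measure X) (M d' : Measure X) ≤ (γ : EReal)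

/-- `ε_α^δ(γ)`: the infimum of all `ε ≥ 0` such that every `(α, γ)`-RDP mechanism from `D` to `X`
is `(ε, δ)`-DP. -/
def epsRDP {D : Type*} (adj : D → D → Prop) (X : Type*) [MeasurableSpace X]
    (α δ γ : ℝ) : ℝ :=
  sInf {ε : ℝ | 0 ≤ ε ∧ ∀ M : Mechanism D X, IsRDP adj M α γ → IsDP adj M ε δ}

/-- `ε^δ(ρ, T) = inf_{α > 1} ε_α^δ(ρ α T)`. -/
def epsComp {D : Type*} (adj : D → D → Prop) (X : Type*) [MeasurableSpace X]
    (δ ρ : ℝ) (T : ℕ) : ℝ :=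
  ⨅ α : Set.Ioi (1 : ℝ), epsRDP adj X α δ (ρ * α * T)

/-! ### The explicit bounds -/

/-- `ζ_α = α⁻¹ (1 - α⁻¹)^(α - 1)`. -/
def zeta (α : ℝ) : ℝ := 1 / α * (1 - 1 / α) ^ (α - 1)

/-- `ε_0(ρ, T)`. -/
def eps0 (δ ρ : ℝ) (T : ℕ) : ℝ :=
  ⨅ α : Set.Ioc (1 : ℝ) (1 / δ),
    max (ρ * α * T - 1 / ((α : ℝ) - 1) * Real.log (δ / zeta α)) 0

/-- `ε_1(ρ, T)`. -/
def eps1 (δ ρ : ℝ) (T : ℕ) : ℝ :=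
  ⨅ α : Set.Ioc (1 : ℝ) (1 / δ),
    1 / ((α : ℝ) - 1) * Real.log (1 + (Real.exp (ρ * α * (α - 1) * T) - 1) / (α * δ))

/-! ### Adaptive composition -/

/-- The joint law of the outputs `(y_0, …, y_{T-1})` of `T` rounds, where round `i` is run with
knowledge of the earlier outputs: `κ i y` is the law of the output of round `i` given that the
earlier outputs are `y = (y_0, …, y_{i-1})`. -/
def adaptiveLaw {X : Type*} [MeasurableSpace X] :
    (T : ℕ) → ((i : Fin T) → Kernel (Fin i → X) X) → Measure (Fin T → X)
  | 0, _ => Measure.dirac Fin.elim0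
  | T + 1, κ =>
    (adaptiveLaw T (fun i => κ i.castSucc) ⊗ₘ κ (Fin.last T)).map
      (fun p => (Fin.snoc p.1 p.2 : Fin (T + 1) → X))

theorem measurable_snoc {X : Type*} [MeasurableSpace X] (T : ℕ) :
    Measurable (fun p : (Fin T → X) × X => (Fin.snoc p.1 p.2 : Fin (T + 1) → X)) := by
  refine measurable_pi_iff.2 fun j => ?_
  refine Fin.lastCases ?_ (fun i => ?_) j
  · simpa using measurable_snd
  · simpa [Function.comp_def] using (measurable_pi_apply i).comp measurable_fst

theorem isProbabilityMeasure_adaptiveLaw {X : Type*} [MeasurableSpace X] (T : ℕ)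
    (κ : (i : Fin T) → Kernel (Fin i → X) X) (hκ : ∀ i, IsMarkovKernel (κ i)) :
    IsProbabilityMeasure (adaptiveLaw T κ) := by
  induction T with
  | zero => unfold adaptiveLaw; infer_instance
  | succ T ih =>
    have h1 := ih (fun i => κ i.castSucc) (fun i => hκ i.castSucc)
    have h2 : IsMarkovKernel (κ (Fin.last T)) := hκ (Fin.last T)
    unfold adaptiveLaw
    exact Measure.isProbabilityMeasure_map (measurable_snoc T).aemeasurable

/-! ### The Gaussian mechanism and its adaptive composition -/

theorem measurable_multivariateGaussian {n : ℕ} {H : Type*} [MeasurableSpace H]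
    (S : Matrix (Fin n) (Fin n) ℝ) {f : H → EuclideanSpace ℝ (Fin n)} (hf : Measurable f) :
    Measurable (fun h => multivariateGaussian (f h) S) := by
  refine Measure.measurable_of_measurable_coe _ fun s hs => ?_
  unfold multivariateGaussian
  generalize Matrix.toEuclideanCLM (n := Fin n) (𝕜 := ℝ) _ = L
  have hm : Measurable (fun p : H × EuclideanSpace ℝ (Fin n) => f p.1 + L p.2) := by fun_prop
  have key : ∀ h, (Measure.map (fun x => f h + L x) (stdGaussian (EuclideanSpace ℝ (Fin n)))) s
      = stdGaussian (EuclideanSpace ℝ (Fin n)) (Prod.mk h ⁻¹'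
          ((fun p : H × EuclideanSpace ℝ (Fin n) => f p.1 + L p.2) ⁻¹' s)) := fun h => by
    rw [Measure.map_apply (by fun_prop) hs]
    rfl
  simp_rw [key]
  exact measurable_measure_prodMk_left (hm hs)

/-- The Gaussian mechanism with variance `σ²` applied to a query value which depends measurably
on a history `h`: the Markov kernel `h ↦ N(f h, σ² I_n)`. -/
def gaussianKernel {n : ℕ} {H : Type*} [MeasurableSpace H] (σ : ℝ)
    (f : H → EuclideanSpace ℝ (Fin n)) (hf : Measurable f) :
    Kernel H (EuclideanSpace ℝ (Fin n)) where
  toFun h := multivariateGaussian (f h) (σ ^ 2 • (1 : Matrix (Fin n) (Fin n) ℝ))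
  measurable' := measurable_multivariateGaussian _ hf

theorem isMarkovKernel_gaussianKernel {n : ℕ} {H : Type*} [MeasurableSpace H] (σ : ℝ)
    (f : H → EuclideanSpace ℝ (Fin n)) (hf : Measurable f) :
    IsMarkovKernel (gaussianKernel σ f hf) :=
  ⟨fun h => by
    change IsProbabilityMeasure (multivariateGaussian (f h) _)
    infer_instance⟩

/-- The `T`-fold adaptive homogeneous composition of the Gaussian mechanism with variance `σ²`.
On dataset `d`, round `i` releases a sample of `N(q i d y, σ² I_n)`, where `y` is the tuple of
outputs of the earlier rounds; the composed mechanism outputs the results of all `T` rounds. -/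
def gaussianComposition {D : Type*} {n : ℕ} (T : ℕ) (σ : ℝ)
    (q : (i : Fin T) → D → (Fin i → EuclideanSpace ℝ (Fin n)) → EuclideanSpace ℝ (Fin n))
    (hq : ∀ i d, Measurable (q i d)) :
    Mechanism D (Fin T → EuclideanSpace ℝ (Fin n)) :=
  fun d => ⟨adaptiveLaw T (fun i => gaussianKernel σ (q i d) (hq i d)),
    isProbabilityMeasure_adaptiveLaw T _ fun i => isMarkovKernel_gaussianKernel σ (q i d) (hq i d)⟩

end RenyiDP

end

namespace RenyiDP

/-! ### Closure properties of the set of privacy parameters -/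

/-! For neighbouring outputs `P`, `Q` and `g = dP/dQ`, the Rényi bound says `E_Q[g ^ α] ≤ exp ((α -
1) γ)`. The function `x ^ α` lies above its tangents; integrating the tangent at `t` over `A` and
the tangent at `u` over the complement gives an inequality linear in `P(A)` and `Q(A)`
(`tangent_bound`). The choice `t = e^ε α / (α - 1)`, `u = 0` yields `ε_0`; the choice `t = e^ε`, `u
= 1` yields `ε_1`. The third bound is the `ε_0` term at `α = 1 / δ`.

For the composition, conditional Gaussian densities multiply, and each has `α`-moment at most `exp
((α - 1) ρ α)` whatever the history (`adaptiveLaw_eq_withDensity`). The whole is thus `(α, ραT)`-RDP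
for every `α > 1`. Since DP is a closed condition on `ε`, the infima over `ε` and `α` are themselves
valid privacy parameters. -/

theorem IsDP.mono {D X : Type*} [MeasurableSpace X] {adj : D → D → Prop} {M : Mechanism D X}
    {ε ε' δ : ℝ} (h : IsDP adj M ε δ) (hε : ε ≤ ε') : IsDP adj M ε' δ := by
  intro d d' hd A hA
  have h1 := h d d' hd A hA
  have h2 : Real.exp ε * (M d' : Measure X).real A ≤ Real.exp ε' * (M d' : Measure X).real A := by
    gcongr
  linarith

/-- For each fixed event the defining expression is continuous in `ε`, so the inequality survives
the limit from the right. -/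
theorem isDP_of_forall_gt {D X : Type*} [MeasurableSpace X] {adj : D → D → Prop}
    {M : Mechanism D X} {ε δ : ℝ} (h : ∀ ε' > ε, IsDP adj M ε' δ) : IsDP adj M ε δ := by
  intro d d' hd A hA
  have hc : Filter.Tendsto
      (fun e => (M d : Measure X).real A - Real.exp e * (M d' : Measure X).real A)
      (nhdsWithin ε (Set.Ioi ε))
      (nhds ((M d : Measure X).real A - Real.exp ε * (M d' : Measure X).real A)) := by
    have : Continuous
        (fun e => (M d : Measure X).real A - Real.exp e * (M d' : Measure X).real A) := by
      fun_prop
    exact this.continuousWithinAt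
  refine le_of_tendsto hc ?_
  filter_upwards [self_mem_nhdsWithin] with e he
  exact h e he d d' hd A hA

theorem epsRDP_nonneg {D : Type*} (adj : D → D → Prop) (X : Type*) [MeasurableSpace X]
    (α δ γ : ℝ) : 0 ≤ epsRDP adj X α δ γ :=
  Real.sInf_nonneg fun _ h => h.1

theorem epsRDP_le {D X : Type*} [MeasurableSpace X] {adj : D → D → Prop} {α δ γ ε : ℝ}
    (hε : 0 ≤ ε) (h : ∀ M : Mechanism D X, IsRDP adj M α γ → IsDP adj M ε δ) :
    epsRDP adj X α δ γ ≤ ε :=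
  csInf_le ⟨0, fun _ h => h.1⟩ ⟨hε, h⟩

theorem epsComp_le {D : Type*} (adj : D → D → Prop) (X : Type*) [MeasurableSpace X]
    {α δ ρ : ℝ} {T : ℕ} (hα : 1 < α) :
    epsComp adj X δ ρ T ≤ epsRDP adj X α δ (ρ * α * T) :=
  ciInf_le (f := fun α : Set.Ioi (1 : ℝ) => epsRDP adj X α δ (ρ * α * T))
    ⟨0, by rintro _ ⟨a, rfl⟩; exact epsRDP_nonneg ..⟩ ⟨α, hα⟩

/-- The infimum defining `epsRDP` is attained as soon as it is taken over a nonempty set. -/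
theorem IsRDP.isDP_epsRDP {D X : Type*} [MeasurableSpace X] {adj : D → D → Prop}
    {M : Mechanism D X} {α δ γ : ℝ} (hM : IsRDP adj M α γ)
    (hne : ∃ ε, 0 ≤ ε ∧ ∀ M : Mechanism D X, IsRDP adj M α γ → IsDP adj M ε δ) :
    IsDP adj M (epsRDP adj X α δ γ) δ := by
  refine isDP_of_forall_gt fun e he => ?_
  -- Nonemptiness matters: the real `sInf` of the empty set is `0`.
  obtain ⟨e', he', hlt⟩ := exists_lt_of_csInf_lt hne he
  exact (he'.2 M hM).mono hlt.le

/-! ### Rényi divergence and moments of the density -/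

section Divergence

variable {X : Type*} [MeasurableSpace X]

theorem inv_mul_log_le_iff {α γ : ℝ} (hα : 1 < α) (I : ℝ≥0∞) :
    ((α - 1)⁻¹ : ℝ) * ENNReal.log I ≤ (γ : EReal) ↔
      I ≤ ENNReal.ofReal (Real.exp ((α - 1) * γ)) := by
  have hpos : 0 < α - 1 := by linarith
  have hipos : 0 < (α - 1)⁻¹ := inv_pos.2 hpos
  rw [← ENNReal.log_le_log_iff, ENNReal.log_ofReal_of_pos (Real.exp_pos _), Real.log_exp]
  induction ENNReal.log I with
  | bot => simp [EReal.coe_mul_bot_of_pos hipos]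
  | top => simp [EReal.coe_mul_top_of_pos hipos, -EReal.coe_mul]
  | coe x =>
    rw [← EReal.coe_mul, EReal.coe_le_coe_iff, EReal.coe_le_coe_iff, inv_mul_le_iff₀ hpos]

theorem renyiDiv_le_iff {α γ : ℝ} (hα : 1 < α) {P Q : Measure X} :
    renyiDiv α P Q ≤ (γ : EReal) ↔
      P ≪ Q ∧ ∫⁻ x, (P.rnDeriv Q x) ^ α ∂Q ≤ ENNReal.ofReal (Real.exp ((α - 1) * γ)) := by
  unfold renyiDiv
  split_ifs with h
  · rw [inv_mul_log_le_iff hα]; simp [h]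
  · simp [h]

/-- Any explicit density can stand in for `rnDeriv`, since the two agree almost everywhere. -/
theorem renyiDiv_le_of_eq_withDensity {α γ : ℝ} (hα : 1 < α) {P Q : Measure X} [SigmaFinite Q]
    {F : X → ℝ≥0∞} (hF : Measurable F) (hPQ : P = Q.withDensity F)
    (hI : ∫⁻ x, F x ^ α ∂Q ≤ ENNReal.ofReal (Real.exp ((α - 1) * γ))) :
    renyiDiv α P Q ≤ (γ : EReal) := by
  subst hPQ
  refine (renyiDiv_le_iff hα).2 ⟨withDensity_absolutelyContinuous _ _, ?_⟩
  refine (lintegral_congr_ae ?_).trans_le hI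
  filter_upwards [Q.rnDeriv_withDensity hF] with x hx
  rw [hx]

/-- Convexity of `x ^ α`: for `t > 0` this is Bernoulli's inequality at `x / t - 1`, scaled by `t ^
α`. -/
theorem tangent_le_rpow {α x t : ℝ} (hα : 1 < α) (hx : 0 ≤ x) (ht : 0 ≤ t) :
    α * t ^ (α - 1) * x - (α - 1) * t ^ α ≤ x ^ α := by
  rcases ht.eq_or_lt with rfl | ht
  · rw [Real.zero_rpow (by linarith), Real.zero_rpow (by linarith)]
    simpa using Real.rpow_nonneg hx α
  have hb := one_add_mul_self_le_rpow_one_add (s := x / t - 1)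
    (by linarith [div_nonneg hx ht.le]) hα.le
  rw [add_sub_cancel, Real.div_rpow hx ht.le, le_div_iff₀ (Real.rpow_pos_of_pos ht α)] at hb
  have htt : t ^ α = t ^ (α - 1) * t := by
    rw [← Real.rpow_add_one ht.ne', sub_add_cancel]
  refine le_trans (le_of_eq ?_) hb
  rw [htt]
  field_simp
  ring

/-- Integrating the tangents of `x ↦ x ^ α` at `t` over `A` and at `u` over the complement. -/
theorem tangent_bound {α C : ℝ} (hα : 1 < α) (hC : 0 ≤ C) {P Q : Measure X}
    [IsProbabilityMeasure P] [IsProbabilityMeasure Q] (hPQ : P ≪ Q)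
    (hI : ∫⁻ x, (P.rnDeriv Q x) ^ α ∂Q ≤ ENNReal.ofReal C)
    {A : Set X} (hA : MeasurableSet A) {t u : ℝ} (ht : 0 ≤ t) (hu : 0 ≤ u) :
    α * t ^ (α - 1) * P.real A - (α - 1) * t ^ α * Q.real A
      + (α * u ^ (α - 1) * (1 - P.real A) - (α - 1) * u ^ α * (1 - Q.real A)) ≤ C := by
  set g : X → ℝ := fun x => (P.rnDeriv Q x).toReal with hg
  have hgi : Integrable g Q := Measure.integrable_toReal_rnDeriv
  have hgm : Measurable fun x => g x ^ α :=
    ((Measure.measurable_rnDeriv P Q).ennreal_toReal).pow_const α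
  have hg0 : ∀ x, 0 ≤ g x := fun x => ENNReal.toReal_nonneg
  have hlin : ∫⁻ x, ENNReal.ofReal (g x ^ α) ∂Q ≤ ENNReal.ofReal C := by
    refine (lintegral_congr_ae ?_).trans_le hI
    filter_upwards [Measure.rnDeriv_lt_top P Q] with x hx
    rw [← ENNReal.ofReal_rpow_of_nonneg (hg0 x) (by linarith), ENNReal.ofReal_toReal hx.ne]
  have hgαi : Integrable (fun x => g x ^ α) Q := by
    refine ⟨hgm.aestronglyMeasurable, ?_⟩
    rw [hasFiniteIntegral_iff_ofReal (.of_forall fun x => Real.rpow_nonneg (hg0 x) α)]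
    exact hlin.trans_lt ENNReal.ofReal_lt_top
  have hgα : ∫ x, g x ^ α ∂Q ≤ C := by
    rw [integral_eq_lintegral_of_nonneg_ae (.of_forall fun x => Real.rpow_nonneg (hg0 x) α)
      hgm.aestronglyMeasurable]
    exact ENNReal.toReal_le_of_le_ofReal hC hlin
  have key : ∀ (B : Set X) (s : ℝ), 0 ≤ s →
      α * s ^ (α - 1) * P.real B - (α - 1) * s ^ α * Q.real B ≤ ∫ x in B, g x ^ α ∂Q := by
    intro B s hs
    have h1 : ∫ x in B, (α * s ^ (α - 1) * g x - (α - 1) * s ^ α) ∂Q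
        = α * s ^ (α - 1) * P.real B - (α - 1) * s ^ α * Q.real B := by
      rw [integral_sub (hgi.integrableOn.const_mul _) (integrable_const _),
        integral_const_mul, Measure.setIntegral_toReal_rnDeriv hPQ]
      simp [mul_comm]
    rw [← h1]
    refine integral_mono ((hgi.integrableOn.const_mul _).sub (integrable_const _))
      hgαi.integrableOn fun x => tangent_le_rpow hα (hg0 x) hs
  have hA1 := key A t ht
  have hA2 := key Aᶜ u hu
  rw [probReal_compl_eq_one_sub hA, probReal_compl_eq_one_sub hA] at hA2
  have hadd := integral_add_compl hA hgαi
  linarith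

end Divergence

/-! ### From Rényi differential privacy to differential privacy -/

theorem zeta_pos {α : ℝ} (hα : 1 < α) : 0 < zeta α := by
  unfold zeta
  have h : 1 / α < 1 := by rw [div_lt_one] <;> linarith
  have h2 : 0 < 1 / α := by positivity
  exact mul_pos h2 (Real.rpow_pos_of_pos (by linarith) _)

section Conversion

variable {D X : Type*} [MeasurableSpace X] {adj : D → D → Prop} {M : Mechanism D X}
  {α δ γ ε : ℝ}

theorem IsRDP.isDP_of_zeta_le (hα : 1 < α) (hδ : 0 < δ)
    (hε : γ - 1 / (α - 1) * Real.log (δ / zeta α) ≤ ε) (hM : IsRDP adj M α γ) :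
    IsDP adj M ε δ := by
  intro d d' hd A hA
  obtain ⟨hac, hI⟩ := (renyiDiv_le_iff hα).1 (hM d d' hd)
  have hα1 : 0 < α - 1 := by linarith
  have hα0 : 0 < α := by linarith
  set s := Real.exp ε with hs
  have hspos : 0 < s := Real.exp_pos ε
  -- This `t` makes the coefficients of `P(A)` and `Q(A)` stand in the ratio `1 : -e^ε`; `u = 0`
  -- discards the complement.
  set t := s * (1 - 1 / α)⁻¹ with ht
  have hw : 0 < 1 - 1 / α := by
    have : 1 / α < 1 := by rw [div_lt_one] <;> linarith
    linarith
  have htpos : 0 < t := by positivity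
  have hb := tangent_bound hα (Real.exp_pos _).le hac hI hA htpos.le le_rfl
  rw [Real.zero_rpow hα1.ne', Real.zero_rpow hα0.ne'] at hb
  have htt : t ^ α = t ^ (α - 1) * t := by
    rw [← Real.rpow_add_one htpos.ne', sub_add_cancel]
  -- The origin of `zeta`: it is the normalisation left by this choice of `t`.
  have htz : α * t ^ (α - 1) * zeta α = s ^ (α - 1) := by
    rw [ht, Real.mul_rpow hspos.le (by positivity), Real.inv_rpow hw.le, zeta]
    have := (Real.rpow_pos_of_pos hw (α - 1)).ne'
    field_simp
  have hst : (α - 1) * t = α * s := by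
    rw [ht]; field_simp
  have hz := zeta_pos hα
  have hmain : α * t ^ (α - 1) *
      ((M d : Measure X).real A - s * (M d' : Measure X).real A) ≤ Real.exp ((α - 1) * γ) := by
    refine le_trans (le_of_eq ?_) hb
    rw [htt]
    linear_combination (t ^ (α - 1) * (M d' : Measure X).real A) * hst
  have hexp : Real.exp ((α - 1) * γ) * zeta α ≤ δ * s ^ (α - 1) := by
    have h1 : (α - 1) * γ ≤ Real.log (δ / zeta α) + ε * (α - 1) := by
      have := mul_le_mul_of_nonneg_left hε hα1.le
      have h2 : (α - 1) * (γ - 1 / (α - 1) * Real.log (δ / zeta α))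
          = (α - 1) * γ - Real.log (δ / zeta α) := by field_simp
      linarith
    have h3 := Real.exp_le_exp.2 h1
    rw [Real.exp_add, Real.exp_log (by positivity), Real.exp_mul ε] at h3
    calc _ ≤ δ / zeta α * s ^ (α - 1) * zeta α := by gcongr
      _ = _ := by field_simp
  have hfin : s ^ (α - 1) * ((M d : Measure X).real A - s * (M d' : Measure X).real A)
      ≤ s ^ (α - 1) * δ := by
    calc _ = α * t ^ (α - 1) *
        ((M d : Measure X).real A - s * (M d' : Measure X).real A) * zeta α := by
          rw [← htz]; ring
      _ ≤ Real.exp ((α - 1) * γ) * zeta α := by gcongr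
      _ ≤ _ := by linarith
  exact le_of_mul_le_mul_left hfin (Real.rpow_pos_of_pos hspos _)

/-- The strict inequality forces `e^ε > 1`, so that the final division by `s ^ (α - 1) - 1` is
legitimate. -/
theorem IsRDP.isDP_of_log_lt (hα : 1 < α) (hδ : 0 < δ) (hγ : 0 ≤ γ)
    (hε : 1 / (α - 1) * Real.log (1 + (Real.exp ((α - 1) * γ) - 1) / (α * δ)) < ε)
    (hM : IsRDP adj M α γ) : IsDP adj M ε δ := by
  have hα1 : 0 < α - 1 := by linarith
  have hα0 : 0 < α := by linarith
  have hC1 : 1 ≤ Real.exp ((α - 1) * γ) := Real.one_le_exp (by positivity)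
  have hfrac : 0 ≤ (Real.exp ((α - 1) * γ) - 1) / (α * δ) :=
    div_nonneg (by linarith) (by positivity)
  have hε0 : 0 < ε :=
    lt_of_le_of_lt (mul_nonneg (by positivity) (Real.log_nonneg (by linarith))) hε
  intro d d' hd A hA
  obtain ⟨hac, hI⟩ := (renyiDiv_le_iff hα).1 (hM d d' hd)
  set s := Real.exp ε with hs
  have hspos : 0 < s := Real.exp_pos ε
  have hs1 : 1 < s := Real.one_lt_exp_iff.2 hε0
  have hb := tangent_bound hα (Real.exp_pos _).le hac hI hA hspos.le zero_le_one
  rw [Real.one_rpow, Real.one_rpow] at hb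
  have hss : s ^ α = s ^ (α - 1) * s := by
    rw [← Real.rpow_add_one hspos.ne', sub_add_cancel]
  -- This is the surplus coefficient of `Q(A)` once `α (s ^ (α - 1) - 1) (P(A) - s Q(A))` is split
  -- off.
  have hbern : 0 ≤ s ^ α - α * s + (α - 1) := by
    have := one_add_mul_self_le_rpow_one_add (s := s - 1) (by linarith) hα.le
    rw [add_sub_cancel] at this
    linarith
  have hu : Real.exp ((α - 1) * γ) - 1 ≤ α * δ * (s ^ (α - 1) - 1) := by
    rw [one_div, inv_mul_lt_iff₀ hα1, Real.log_lt_iff_lt_exp (by linarith),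
      mul_comm (α - 1) ε, Real.exp_mul ε, ← hs] at hε
    have : (Real.exp ((α - 1) * γ) - 1) / (α * δ) ≤ s ^ (α - 1) - 1 := by linarith
    rwa [div_le_iff₀' (by positivity)] at this
  have hu1 : 1 < s ^ (α - 1) := Real.one_lt_rpow hs1 hα1
  have hq : 0 ≤ (M d' : Measure X).real A * (s ^ α - α * s + (α - 1)) :=
    mul_nonneg measureReal_nonneg hbern
  have hfin : α * (s ^ (α - 1) - 1) *
      ((M d : Measure X).real A - s * (M d' : Measure X).real A)
      ≤ α * (s ^ (α - 1) - 1) * δ := by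
    rw [hss] at hb hq
    nlinarith [hb, hq, hu]
  exact le_of_mul_le_mul_left hfin (mul_pos hα0 (by linarith))

end Conversion

/-! ### The explicit bounds -/

theorem epsComp_le_eps0_term {D : Type*} (adj : D → D → Prop) (X : Type*) [MeasurableSpace X]
    {α δ ρ : ℝ} {T : ℕ} (hδ : 0 < δ) (hα : 1 < α) :
    epsComp adj X δ ρ T ≤ max (ρ * α * T - 1 / (α - 1) * Real.log (δ / zeta α)) 0 :=
  (epsComp_le adj X hα).trans <| epsRDP_le (le_max_right _ _) fun _ hM =>
    hM.isDP_of_zeta_le hα hδ (le_max_left _ _)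

theorem epsComp_le_eps1_term {D : Type*} (adj : D → D → Prop) (X : Type*) [MeasurableSpace X]
    {α δ ρ : ℝ} {T : ℕ} (hδ : 0 < δ) (hρ : 0 ≤ ρ) (hα : 1 < α) :
    epsComp adj X δ ρ T ≤
      1 / (α - 1) * Real.log (1 + (Real.exp (ρ * α * (α - 1) * T) - 1) / (α * δ)) := by
  have hγ : 0 ≤ ρ * α * T := by positivity
  refine (epsComp_le adj X hα).trans (le_of_forall_gt_imp_ge_of_dense fun e he => ?_)
  have he' : 1 / (α - 1) *
      Real.log (1 + (Real.exp ((α - 1) * (ρ * α * T)) - 1) / (α * δ)) < e := by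
    rwa [show (α - 1) * (ρ * α * T) = ρ * α * (α - 1) * T by ring]
  have hC1 : 1 ≤ Real.exp ((α - 1) * (ρ * α * T)) :=
    Real.one_le_exp (mul_nonneg (by linarith) hγ)
  have hα0 : 0 < α := by linarith
  have he0 : 0 ≤ e := by
    refine le_trans (mul_nonneg ?_ (Real.log_nonneg ?_)) he'.le
    · exact one_div_nonneg.2 (by linarith)
    · exact le_add_of_nonneg_right (div_nonneg (by linarith) (by positivity))
  exact epsRDP_le he0 fun _ hM => hM.isDP_of_log_lt hα hδ hγ he'

theorem one_div_mem_Ioc {δ : ℝ} (hδ0 : 0 < δ) (hδ1 : δ < 1) :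
    1 / δ ∈ Set.Ioc (1 : ℝ) (1 / δ) :=
  ⟨by rwa [lt_div_iff₀ hδ0, one_mul], le_rfl⟩

/-- At `α = 1 / δ` the factor `δ` of `zeta` cancels, and the remaining exponent `α - 1` cancels the
prefactor of the logarithm. -/
theorem eps0_term_one_div {δ ρ : ℝ} {T : ℕ} (hδ0 : 0 < δ) (hδ1 : δ < 1) :
    ρ * (1 / δ) * T - 1 / (1 / δ - 1) * Real.log (δ / zeta (1 / δ))
      = ρ * T / δ + Real.log (1 - δ) := by
  have h1 : 0 < 1 - δ := by linarith
  have h2 : 1 / δ - 1 ≠ 0 := by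
    have := (one_div_mem_Ioc hδ0 hδ1).1
    linarith
  have h3 : δ / zeta (1 / δ) = ((1 - δ) ^ (1 / δ - 1))⁻¹ := by
    rw [zeta, one_div_one_div, div_mul_eq_div_div, div_self hδ0.ne', one_div]
  rw [h3, Real.log_inv, Real.log_rpow h1, one_div_mul_eq_div, mul_comm (1 / δ - 1), ← neg_mul,
    mul_div_assoc, div_self h2]
  ring

theorem epsComp_le_min {D : Type*} (adj : D → D → Prop) (X : Type*) [MeasurableSpace X]
    {δ ρ : ℝ} {T : ℕ} (hδ0 : 0 < δ) (hδ1 : δ < 1) (hρ : 0 ≤ ρ) :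
    epsComp adj X δ ρ T ≤
      min (min (eps0 δ ρ T) (eps1 δ ρ T)) (max (ρ * T / δ + Real.log (1 - δ)) 0) := by
  have : Nonempty (Set.Ioc (1 : ℝ) (1 / δ)) := ⟨⟨_, one_div_mem_Ioc hδ0 hδ1⟩⟩
  refine le_min (le_min ?_ ?_) ?_
  · exact le_ciInf fun α => epsComp_le_eps0_term adj X hδ0 α.2.1
  · exact le_ciInf fun α => epsComp_le_eps1_term adj X hδ0 hρ α.2.1
  · rw [← eps0_term_one_div hδ0 hδ1]
    exact epsComp_le_eps0_term adj X hδ0 (one_div_mem_Ioc hδ0 hδ1).1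

theorem isDP_epsComp {D X : Type*} [MeasurableSpace X] {adj : D → D → Prop} {M : Mechanism D X}
    {δ ρ : ℝ} {T : ℕ} (hδ : 0 < δ) (hM : ∀ α, 1 < α → IsRDP adj M α (ρ * α * T)) :
    IsDP adj M (epsComp adj X δ ρ T) δ := by
  refine isDP_of_forall_gt fun e he => ?_
  have : Nonempty (Set.Ioi (1 : ℝ)) := ⟨⟨2, by simp⟩⟩
  obtain ⟨α, hα⟩ := exists_lt_of_ciInf_lt he
  -- The `ε_0` term at `α` is an admissible `ε`, which gives the required nonemptiness.
  exact IsDP.mono ((hM α α.2).isDP_epsRDP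
    ⟨max (ρ * α * T - 1 / ((α : ℝ) - 1) * Real.log (δ / zeta α)) 0, le_max_right _ _,
      fun _ hM' => hM'.isDP_of_zeta_le α.2 hδ (le_max_left _ _)⟩) hα.le

end RenyiDP

namespace RenyiDP

/-! ### Translates of the standard Gaussian measure -/

section Gaussian

open scoped RealInnerProductSpace

variable {E : Type*} [NormedAddCommGroup E] [InnerProductSpace ℝ E] [FiniteDimensional ℝ E]
  [MeasurableSpace E] [BorelSpace E]

/-- In an orthonormal basis the integral factors into one-dimensional complex moment generating
functions. `t = 0` gives real exponential moments; general `t` gives the characteristic function of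
the tilted measure. -/
theorem integral_cexp_inner_stdGaussian (v t : E) :
    ∫ x, Complex.exp (⟪x, v⟫ + ⟪x, t⟫ * Complex.I) ∂(stdGaussian E)
      = Complex.exp ((‖v‖ ^ 2 - ‖t‖ ^ 2) / 2 + ⟪v, t⟫ * Complex.I) := by
  set b := stdOrthonormalBasis ℝ E with hb
  set z : Fin (Module.finrank ℝ E) → ℂ := fun i => ⟪b i, v⟫ + ⟪b i, t⟫ * Complex.I with hz
  rw [stdGaussian, integral_map (Measurable.aemeasurable (by fun_prop))
    (Measurable.aestronglyMeasurable (by fun_prop))]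
  have h1 : ∀ x : Fin (Module.finrank ℝ E) → ℝ,
      Complex.exp (⟪∑ i, x i • b i, v⟫ + ⟪∑ i, x i • b i, t⟫ * Complex.I)
        = ∏ i, Complex.exp (z i * x i) := by
    intro x
    rw [← Complex.exp_sum]
    congr 1
    simp only [sum_inner, real_inner_smul_left, Complex.ofReal_sum, Complex.ofReal_mul,
      Finset.sum_mul, ← Finset.sum_add_distrib, hz]
    exact Finset.sum_congr rfl fun i _ => by ring
  simp_rw [← hb, h1]
  rw [integral_fintype_prod_eq_prod (f := fun i (x : ℝ) => Complex.exp (z i * x))]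
  have h2 : ∀ i, ∫ x : ℝ, Complex.exp (z i * x) ∂(gaussianReal 0 1)
      = Complex.exp (z i ^ 2 / 2) := fun i => by
    simpa [complexMGF] using complexMGF_id_gaussianReal (μ := 0) (v := 1) (z i)
  simp_rw [h2]
  rw [← Complex.exp_sum]
  congr 1
  have e1 : ∀ i, z i ^ 2 / 2 = ((⟪b i, v⟫ ^ 2 - ⟪b i, t⟫ ^ 2) / 2 : ℝ)
      + (⟪v, b i⟫ * ⟪b i, t⟫ : ℝ) * Complex.I := fun i => by
    rw [real_inner_comm (b i) v]
    simp only [hz]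
    push_cast
    linear_combination (⟪b i, t⟫ : ℂ) ^ 2 / 2 * Complex.I_sq
  simp_rw [e1]
  rw [Finset.sum_add_distrib, ← Finset.sum_mul, ← Complex.ofReal_sum, ← Complex.ofReal_sum,
    b.sum_inner_mul_inner, ← Finset.sum_div, Finset.sum_sub_distrib, b.sum_sq_inner_right,
    b.sum_sq_inner_right]
  push_cast
  rfl

/-- The density of the translate by `v` of the standard Gaussian measure. -/
noncomputable def shiftDensity (v x : E) : ℝ≥0∞ :=
  ENNReal.ofReal (Real.exp (⟪x, v⟫ - ‖v‖ ^ 2 / 2))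

theorem measurable_shiftDensity_comp {H : Type*} [MeasurableSpace H] {f g : H → E}
    (hf : Measurable f) (hg : Measurable g) : Measurable fun h => shiftDensity (f h) (g h) := by
  unfold shiftDensity
  exact (((hg.inner hf).sub ((hf.norm.pow_const 2).div_const 2)).exp).ennreal_ofReal

theorem measurable_shiftDensity (v : E) : Measurable (shiftDensity v) :=
  measurable_shiftDensity_comp (f := fun _ => v) measurable_const measurable_id

theorem integral_exp_inner_stdGaussian (v : E) :
    ∫ x, Real.exp ⟪x, v⟫ ∂(stdGaussian E) = Real.exp (‖v‖ ^ 2 / 2) := by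
  have h := integral_cexp_inner_stdGaussian v 0
  simp only [inner_zero_right, Complex.ofReal_zero, zero_mul, add_zero, norm_zero] at h
  rw [← Complex.ofReal_inj, ← integral_complex_ofReal]
  push_cast
  rw [h]
  simp

theorem integrable_exp_inner_stdGaussian (v : E) :
    Integrable (fun x => Real.exp ⟪x, v⟫) (stdGaussian E) :=
  -- A nonintegrable function would have integral `0`.
  Integrable.of_integral_ne_zero (by rw [integral_exp_inner_stdGaussian]; positivity)

theorem lintegral_shiftDensity (v : E) : ∫⁻ x, shiftDensity v x ∂(stdGaussian E) = 1 := by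
  simp only [shiftDensity]
  rw [← ofReal_integral_eq_lintegral_ofReal]
  · simp_rw [Real.exp_sub]
    rw [integral_div, integral_exp_inner_stdGaussian, div_self (Real.exp_pos _).ne',
      ENNReal.ofReal_one]
  · simp_rw [Real.exp_sub]
    exact (integrable_exp_inner_stdGaussian v).div_const _
  · exact .of_forall fun x => (Real.exp_pos _).le

/-- Up to a constant, the `α`-th power is the density of the translate by `α • v`, whose total mass
is one. -/
theorem lintegral_shiftDensity_rpow {α : ℝ} (hα : 0 ≤ α) (v : E) :
    ∫⁻ x, shiftDensity v x ^ α ∂(stdGaussian E)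
      = ENNReal.ofReal (Real.exp (α * (α - 1) * ‖v‖ ^ 2 / 2)) := by
  have h : ∀ x : E, shiftDensity v x ^ α =
      ENNReal.ofReal (Real.exp (α * (α - 1) * ‖v‖ ^ 2 / 2)) * shiftDensity (α • v) x := fun x => by
    simp only [shiftDensity]
    rw [ENNReal.ofReal_rpow_of_nonneg (Real.exp_pos _).le hα, ← Real.exp_mul,
      ← ENNReal.ofReal_mul (Real.exp_pos _).le, ← Real.exp_add, inner_smul_right, norm_smul,
      mul_pow, Real.norm_eq_abs, sq_abs]
    congr 2
    ring
  simp_rw [h]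
  rw [lintegral_const_mul _ (measurable_shiftDensity _),
    lintegral_shiftDensity, mul_one]

/-- Cameron–Martin formula, by comparison of characteristic functions. -/
theorem map_const_add_stdGaussian (v : E) :
    (stdGaussian E).map (fun x => v + x) = (stdGaussian E).withDensity (shiftDensity v) := by
  have hm := measurable_shiftDensity v
  have : IsProbabilityMeasure ((stdGaussian E).map (fun x => v + x)) :=
    Measure.isProbabilityMeasure_map (by fun_prop)
  have : IsFiniteMeasure ((stdGaussian E).withDensity (shiftDensity v)) :=
    isFiniteMeasure_withDensity (by rw [lintegral_shiftDensity]; exact ENNReal.one_ne_top)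
  refine Measure.ext_of_charFun (funext fun t => ?_)
  rw [charFun_apply, charFun_apply, integral_map (by fun_prop)
    (Measurable.aestronglyMeasurable (by fun_prop)),
    integral_withDensity_eq_integral_toReal_smul hm
      (.of_forall fun x => ENNReal.ofReal_lt_top)]
  have h1 : ∀ x : E, Complex.exp (⟪v + x, t⟫ * Complex.I) =
      Complex.exp (⟪v, t⟫ * Complex.I) *
        Complex.exp (⟪x, (0 : E)⟫ + ⟪x, t⟫ * Complex.I) := fun x => by
    rw [← Complex.exp_add, inner_add_left, inner_zero_right]
    push_cast
    ring_nf
  have h2 : ∀ x : E, (shiftDensity v x).toReal • Complex.exp (⟪x, t⟫ * Complex.I) =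
      Complex.exp (-‖v‖ ^ 2 / 2) * Complex.exp (⟪x, v⟫ + ⟪x, t⟫ * Complex.I) := fun x => by
    rw [shiftDensity, ENNReal.toReal_ofReal (Real.exp_pos _).le, Complex.real_smul,
      Complex.ofReal_exp, ← Complex.exp_add, ← Complex.exp_add]
    push_cast
    ring_nf
  simp_rw [h1, h2]
  rw [integral_const_mul, integral_const_mul, integral_cexp_inner_stdGaussian,
    integral_cexp_inner_stdGaussian, ← Complex.exp_add, ← Complex.exp_add, inner_zero_left,
    norm_zero]
  push_cast
  ring_nf

end Gaussian

/-! ### Gaussians with covariance `σ² I` -/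

section ScalarCovariance

variable {n : ℕ}

open scoped MatrixOrder in
theorem multivariateGaussian_scalar {σ : ℝ} (hσ : 0 < σ) (a : EuclideanSpace ℝ (Fin n)) :
    multivariateGaussian a (σ ^ 2 • (1 : Matrix (Fin n) (Fin n) ℝ))
      = (stdGaussian (EuclideanSpace ℝ (Fin n))).map (fun x => a + σ • x) := by
  have hs : CFC.sqrt (σ ^ 2 • (1 : Matrix (Fin n) (Fin n) ℝ)) = σ • 1 := by
    refine CFC.sqrt_unique ?_ ?_
    · rw [smul_mul_smul_comm, one_mul, sq]
    · exact (Matrix.PosSemidef.one.smul hσ.le).nonneg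
  rw [multivariateGaussian, hs, map_smul, map_one]
  rfl

/-- The density of `N(a, σ² I)` with respect to `N(b, σ² I)`. -/
noncomputable def gaussianRatio (σ : ℝ) (a b x : EuclideanSpace ℝ (Fin n)) : ℝ≥0∞ :=
  shiftDensity (σ⁻¹ • (a - b)) (σ⁻¹ • (x - b))

theorem measurable_gaussianRatio_comp (σ : ℝ) {H : Type*} [MeasurableSpace H]
    {f g h : H → EuclideanSpace ℝ (Fin n)} (hf : Measurable f) (hg : Measurable g)
    (hh : Measurable h) : Measurable fun y => gaussianRatio σ (f y) (g y) (h y) :=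
  measurable_shiftDensity_comp (by fun_prop) (by fun_prop)

theorem measurable_gaussianRatio (σ : ℝ) (a b : EuclideanSpace ℝ (Fin n)) :
    Measurable (gaussianRatio σ a b) :=
  measurable_gaussianRatio_comp σ (f := fun _ => a) (g := fun _ => b) measurable_const
    measurable_const measurable_id

theorem gaussianRatio_add_smul {σ : ℝ} (hσ : σ ≠ 0) (a b x : EuclideanSpace ℝ (Fin n)) :
    gaussianRatio σ a b (b + σ • x) = shiftDensity (σ⁻¹ • (a - b)) x := by
  rw [gaussianRatio, add_sub_cancel_left, inv_smul_smul₀ hσ]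

/-- Change of variables for a density which is given on the target of a map. -/
theorem map_withDensity_comp {X Y : Type*} [MeasurableSpace X] [MeasurableSpace Y] {μ : Measure X}
    {f : X → Y} (hf : Measurable f) {F : Y → ℝ≥0∞} (hF : Measurable F) :
    (μ.withDensity (F ∘ f)).map f = (μ.map f).withDensity F := by
  ext s hs
  rw [Measure.map_apply hf hs, withDensity_apply _ (hf hs), withDensity_apply _ hs,
    setLIntegral_map hs hF hf]
  rfl

theorem multivariateGaussian_eq_withDensity {σ : ℝ} (hσ : 0 < σ)
    (a b : EuclideanSpace ℝ (Fin n)) :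
    multivariateGaussian a (σ ^ 2 • (1 : Matrix (Fin n) (Fin n) ℝ))
      = (multivariateGaussian b (σ ^ 2 • (1 : Matrix (Fin n) (Fin n) ℝ))).withDensity
          (gaussianRatio σ a b) := by
  rw [multivariateGaussian_scalar hσ, multivariateGaussian_scalar hσ,
    ← map_withDensity_comp (by fun_prop) (measurable_gaussianRatio σ a b)]
  have h : gaussianRatio σ a b ∘ (fun x => b + σ • x) = shiftDensity (σ⁻¹ • (a - b)) :=
    funext fun x => gaussianRatio_add_smul hσ.ne' a b x
  rw [h, ← map_const_add_stdGaussian, Measure.map_map (by fun_prop) (by fun_prop)]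
  congr 1
  ext1 x
  simp only [Function.comp_apply, smul_add, smul_inv_smul₀ hσ.ne']
  abel

theorem lintegral_gaussianRatio_rpow_le {σ α : ℝ} (hσ : 0 < σ) (hα : 1 < α)
    {a b : EuclideanSpace ℝ (Fin n)} (hab : ‖a - b‖ ≤ 1) :
    ∫⁻ x, gaussianRatio σ a b x ^ α
        ∂(multivariateGaussian b (σ ^ 2 • (1 : Matrix (Fin n) (Fin n) ℝ)))
      ≤ ENNReal.ofReal (Real.exp ((α - 1) * (1 / (2 * σ ^ 2) * α))) := by
  rw [multivariateGaussian_scalar hσ, lintegral_map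
    ((measurable_gaussianRatio σ a b).pow_const α) (by fun_prop)]
  simp_rw [gaussianRatio_add_smul hσ.ne']
  rw [lintegral_shiftDensity_rpow (by linarith)]
  refine ENNReal.ofReal_le_ofReal (Real.exp_le_exp.2 ?_)
  have h1 : ‖a - b‖ ^ 2 ≤ 1 := pow_le_one₀ (norm_nonneg _) hab
  have h2 : 0 ≤ α * (α - 1) / (2 * σ ^ 2) :=
    div_nonneg (mul_nonneg (by linarith) (by linarith)) (by positivity)
  rw [norm_smul, mul_pow, norm_inv, Real.norm_eq_abs, inv_pow, sq_abs]
  calc _ = α * (α - 1) / (2 * σ ^ 2) * ‖a - b‖ ^ 2 := by field_simp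
    _ ≤ α * (α - 1) / (2 * σ ^ 2) * 1 := by gcongr
    _ = _ := by field_simp

end ScalarCovariance

/-! ### Adaptive composition -/

theorem compProd_eq_withDensity {X Y : Type*} [MeasurableSpace X] [MeasurableSpace Y]
    {μ : Measure X} [SFinite μ] {κ η : Kernel X Y} [IsSFiniteKernel κ] [IsSFiniteKernel η]
    {F : X → ℝ≥0∞} (hF : Measurable F) [SFinite (μ.withDensity F)]
    {g : X → Y → ℝ≥0∞} (hg : Measurable (Function.uncurry g))
    (hκ : ∀ x, κ x = (η x).withDensity (g x)) :
    (μ.withDensity F) ⊗ₘ κ = (μ ⊗ₘ η).withDensity (fun p => F p.1 * g p.1 p.2) := by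
  have hFg : Measurable (fun p : X × Y => F p.1 * g p.1 p.2) := (hF.comp measurable_fst).mul hg
  ext s hs
  rw [Measure.compProd_apply hs, withDensity_apply _ hs, ← lintegral_indicator hs,
    Measure.lintegral_compProd (hFg.indicator hs),
    lintegral_withDensity_eq_lintegral_mul _ hF (Kernel.measurable_kernel_prodMk_left hs)]
  refine lintegral_congr fun x => ?_
  have hsx : MeasurableSet (Prod.mk x ⁻¹' s) := measurable_prodMk_left hs
  have hgx : Measurable (g x) := hg.of_uncurry_left
  rw [Pi.mul_apply, hκ, withDensity_apply _ hsx, ← lintegral_indicator hsx,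
    ← lintegral_const_mul _ (hgx.indicator hsx)]
  refine lintegral_congr fun y => ?_
  by_cases hy : (x, y) ∈ s
  · simp [Set.indicator, hy]
  · simp [Set.indicator, hy]

/-- The density is the product of the conditional ones. As `C` is uniform in the history,
integrating out the last output costs one factor `C`. -/
theorem adaptiveLaw_eq_withDensity {X : Type*} [MeasurableSpace X] {α : ℝ} (hα : 0 ≤ α)
    {C : ℝ≥0∞} (T : ℕ) (κ η : (i : Fin T) → Kernel (Fin i → X) X)
    (hκ : ∀ i, IsMarkovKernel (κ i)) (hη : ∀ i, IsMarkovKernel (η i))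
    (g : (i : Fin T) → (Fin i → X) → X → ℝ≥0∞)
    (hg : ∀ i, Measurable (Function.uncurry (g i)))
    (hd : ∀ i y, κ i y = (η i y).withDensity (g i y))
    (hC : ∀ i y, ∫⁻ x, g i y x ^ α ∂(η i y) ≤ C) :
    ∃ F : (Fin T → X) → ℝ≥0∞, Measurable F ∧
      adaptiveLaw T κ = (adaptiveLaw T η).withDensity F ∧
      ∫⁻ y, F y ^ α ∂(adaptiveLaw T η) ≤ C ^ T := by
  induction T with
  | zero =>
    refine ⟨fun _ => 1, measurable_const, ?_, ?_⟩
    · simp [adaptiveLaw, withDensity_const]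
    · simp [adaptiveLaw]
  | succ T ih =>
    obtain ⟨F, hF, hFd, hFC⟩ := ih (fun i => κ i.castSucc) (fun i => η i.castSucc)
      (fun i => hκ _) (fun i => hη _) (fun i => g i.castSucc) (fun i => hg i.castSucc)
      (fun i => hd i.castSucc) (fun i => hC i.castSucc)
    have := hκ (Fin.last T)
    have := hη (Fin.last T)
    have hPp := isProbabilityMeasure_adaptiveLaw T (fun i => κ i.castSucc) (fun i => hκ _)
    have := isProbabilityMeasure_adaptiveLaw T (fun i => η i.castSucc) (fun i => hη _)
    -- This supplies the `SFinite` instance for the measure with density `F`.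
    rw [hFd] at hPp
    have hgl : Measurable fun p : (Fin T → X) × X => g (Fin.last T) p.1 p.2 := hg (Fin.last T)
    have hsnoc := measurable_snoc (X := X) T
    have hinv : Measurable fun y : Fin (T + 1) → X => ((Fin.init y : Fin T → X), y (Fin.last T)) :=
      (measurable_pi_iff.2 fun i => measurable_pi_apply i.castSucc).prodMk (measurable_pi_apply _)
    have hG : Measurable fun p : (Fin T → X) × X => F p.1 * g (Fin.last T) p.1 p.2 :=
      (hF.comp measurable_fst).mul hgl
    have hGi : Measurable fun y : Fin (T + 1) → X =>
        F (Fin.init y) * g (Fin.last T) (Fin.init y) (y (Fin.last T)) := hG.comp hinv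
    refine ⟨fun y => F (Fin.init y) * g (Fin.last T) (Fin.init y) (y (Fin.last T)),
      hGi, ?_, ?_⟩
    · unfold adaptiveLaw
      rw [hFd, compProd_eq_withDensity hF (hg (Fin.last T)) (hd (Fin.last T)),
        ← map_withDensity_comp hsnoc hGi]
      simp only [Function.comp_def, Fin.init_snoc, Fin.snoc_last]
    · unfold adaptiveLaw
      rw [lintegral_map (hGi.pow_const α) hsnoc]
      simp only [Fin.init_snoc, Fin.snoc_last]
      rw [Measure.lintegral_compProd (hG.pow_const α)]
      calc _ ≤ ∫⁻ y, F y ^ α * C ∂(adaptiveLaw T fun i => η i.castSucc) := by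
            refine lintegral_mono fun y => ?_
            simp_rw [ENNReal.mul_rpow_of_nonneg _ _ hα]
            rw [lintegral_const_mul _ (((hg (Fin.last T)).of_uncurry_left).pow_const α)]
            exact mul_le_mul_right (hC (Fin.last T) y) _
        _ ≤ C ^ T * C := by
            rw [lintegral_mul_const _ (hF.pow_const α)]
            exact mul_le_mul_left hFC C
        _ = C ^ (T + 1) := (pow_succ C T).symm

theorem isRDP_gaussianComposition {D : Type*} {adj : D → D → Prop} {n T : ℕ} {σ α : ℝ}
    (hσ : 0 < σ) (hα : 1 < α)
    {q : (i : Fin T) → D → (Fin i → EuclideanSpace ℝ (Fin n)) → EuclideanSpace ℝ (Fin n)}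
    (hq : ∀ i d, Measurable (q i d))
    (hsens : ∀ i d d', adj d d' → ∀ y, ‖q i d y - q i d' y‖ ≤ 1) :
    IsRDP adj (gaussianComposition T σ q hq) α (1 / (2 * σ ^ 2) * α * T) := by
  intro d d' hd
  obtain ⟨F, hF, hFd, hFC⟩ := adaptiveLaw_eq_withDensity (α := α) (by linarith) T
    (fun i => gaussianKernel σ (q i d) (hq i d)) (fun i => gaussianKernel σ (q i d') (hq i d'))
    (fun i => isMarkovKernel_gaussianKernel σ _ _) (fun i => isMarkovKernel_gaussianKernel σ _ _)
    (fun i y => gaussianRatio σ (q i d y) (q i d' y))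
    (fun i => measurable_gaussianRatio_comp σ ((hq i d).comp measurable_fst)
      ((hq i d').comp measurable_fst) measurable_snd)
    (fun i y => multivariateGaussian_eq_withDensity hσ (q i d y) (q i d' y))
    (fun i y => lintegral_gaussianRatio_rpow_le hσ hα (hsens i d d' hd y))
  have := isProbabilityMeasure_adaptiveLaw T
    (fun i => gaussianKernel σ (q i d') (hq i d')) fun i => isMarkovKernel_gaussianKernel σ _ _
  refine renyiDiv_le_of_eq_withDensity (Q := adaptiveLaw T _) hα hF hFd (hFC.trans_eq ?_)
  rw [← ENNReal.ofReal_pow (Real.exp_pos _).le, ← Real.exp_nat_mul]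
  congr 2
  ring

end RenyiDP

theorem mainTheorem7 {D : Type*} (adj : D → D → Prop) (n T : ℕ) (σ δ : ℝ)
    (hσ : 0 < σ) (hδ0 : 0 < δ) (hδ1 : δ < 1) :
    (∀ (q : (i : Fin T) → D → (Fin i → EuclideanSpace ℝ (Fin n)) → EuclideanSpace ℝ (Fin n))
        (hq : ∀ i d, Measurable (q i d)),
        (∀ i d d', adj d d' → ∀ y, ‖q i d y - q i d' y‖ ≤ 1) →
        RenyiDP.IsDP adj (RenyiDP.gaussianComposition T σ q hq)
          (RenyiDP.epsComp adj (Fin T → EuclideanSpace ℝ (Fin n)) δ (1 / (2 * σ ^ 2)) T) δ) ∧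
    (∀ (X : Type*) [MeasurableSpace X],
        RenyiDP.epsComp adj X δ (1 / (2 * σ ^ 2)) T ≤
          min (min (RenyiDP.eps0 δ (1 / (2 * σ ^ 2)) T) (RenyiDP.eps1 δ (1 / (2 * σ ^ 2)) T))
            (max (1 / (2 * σ ^ 2) * T / δ + Real.log (1 - δ)) 0)) := by
  have hρ : 0 ≤ 1 / (2 * σ ^ 2) := by positivity
  exact ⟨fun q hq hsens => RenyiDP.isDP_epsComp hδ0 fun α hα =>
      RenyiDP.isRDP_gaussianComposition hσ hα hq hsens,
    fun X _ => RenyiDP.epsComp_le_min adj X hδ0 hδ1 hρ⟩
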